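/- Let $\nu_0,\nu_1,\nu_2\in i\mathbb{R}_{\geq 0}$ satisfy $\nu_0=\nu_1+\nu_2$, and put \[ T_0:=\max(2,|\nu_0|,|\nu_1|,|\nu_2|),\qquad \lambda:=1-3\nu_1^2-3\nu_1\nu_2-3\nu_2^2>0 . \] For $y_1,y_2>0$ let \[ \tilde W_{\nu_1,\nu_2}(y_1,y_2):=4\pi^{3/2}\prod_{j=0}^{2}\left|\Gamma\left(\tfrac12+\tfrac32\nu_j\right)\right|^{-1} y_1y_2\left(\frac{y_1}{y_2}\right)^{\frac{\nu_1-\nu_2}{2}}\int_0^\infty K_{\frac32\nu_0}\left(2\pi y_1\sqrt{1+u}\right)K_{\frac32\nu_0}\left(2\pi y_2\sqrt{1+u^{-1}}\right)u^{\frac34(\nu_1-\nu_2)}\,\frac{du}{u} \] be the normalized $\mathrm{GL}_3$ Jacquet--Whittaker function on the diagonal, where $K_\nu(x)=\int_0^\infty e^{-x\cosh t}\cosh(\nu t)\,dt$ $(x>0)$ is the $K$-Bessel function. Then $T_0\asymp\lambda^{1/2}$ with absolute implied constants, the integral over $u$ converges absolutely, and for every $A>0$ there is a constant $C_A>0$,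 depending only on $A$, such that for all such $\nu_0,\nu_1,\nu_2$ and all $y_1,y_2>0$, \[ \left|\tilde W_{\nu_1,\nu_2}(y_1,y_2)\right|\leq C_A\,(\log T_0)\sqrt{y_1y_2}\left(1+\frac{y_1}{T_0}\right)^{-A}\left(1+\frac{y_2}{T_0}\right)^{-A}. \] -/

import Mathlib

open MeasureTheory

/-- The integrand `exp (-x cosh t) * cosh (ν t)` of the modified Bessel function of the second
kind. -/
noncomputable def besselKIntegrand (ν : ℂ) (x t : ℝ) : ℂ :=
  (Real.exp (-x * Real.cosh t) : ℂ) * Complex.cosh (ν * t)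

/-- The `K`-Bessel function `K_ν(x) = ∫_0^∞ exp (-x cosh t) cosh (ν t) dt` for `ν ∈ ℂ` and
`x > 0`. -/
noncomputable def besselK (ν : ℂ) (x : ℝ) : ℂ :=
  ∫ t in Set.Ioi (0 : ℝ), besselKIntegrand ν x t

/-- The integral that defines `besselK ν x` converges absolutely for every `ν ∈ ℂ` and `x > 0`. -/
theorem integrableOn_besselKIntegrand (ν : ℂ) {x : ℝ} (hx : 0 < x) :
    IntegrableOn (besselKIntegrand ν x) (Set.Ioi 0) := by
  have hg : Integrable (fun t : ℝ => Real.exp (‖ν‖ ^ 2 / x) * Real.exp (-(x / 4) * t ^ 2)) :=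
    (integrable_exp_neg_mul_sq (by positivity)).const_mul _
  refine Integrable.mono' hg.integrableOn ?_ ?_
  · apply Continuous.aestronglyMeasurable
    unfold besselKIntegrand
    fun_prop
  · filter_upwards [ae_restrict_mem measurableSet_Ioi] with t ht
    have ht' : 0 < t := ht
    have h1 : ‖Complex.cosh (ν * t)‖ ≤ Real.exp (‖ν‖ * t) := by
      have hz : ‖ν * (t : ℂ)‖ = ‖ν‖ * t := by
        rw [norm_mul, Complex.norm_real, Real.norm_of_nonneg ht'.le]
      have ha := Complex.norm_exp_le_exp_norm (ν * t)
      have hb := Complex.norm_exp_le_exp_norm (-(ν * t))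
      rw [norm_neg] at hb
      rw [hz] at ha hb
      rw [Complex.cosh, norm_div]
      have hc := norm_add_le (Complex.exp (ν * t)) (Complex.exp (-(ν * t)))
      simp only [RCLike.norm_ofNat]
      linarith
    have h2 : 1 + t ^ 2 / 2 ≤ Real.cosh t := by
      have h3 : Real.cosh t = 1 + 2 * Real.sinh (t / 2) ^ 2 := by
        have h4 := Real.cosh_two_mul (t / 2)
        have h5 := Real.cosh_sq (t / 2)
        rw [show 2 * (t / 2) = t by ring] at h4
        linarith
      have h6 : t / 2 ≤ Real.sinh (t / 2) := Real.self_le_sinh_iff.2 (by positivity)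
      have h7 : (t / 2) ^ 2 ≤ Real.sinh (t / 2) ^ 2 := pow_le_pow_left₀ (by positivity) h6 2
      nlinarith
    have h8 : -x * Real.cosh t + ‖ν‖ * t ≤ ‖ν‖ ^ 2 / x + -(x / 4) * t ^ 2 := by
      have h9 : ‖ν‖ * t ≤ ‖ν‖ ^ 2 / x + x / 4 * t ^ 2 := by
        have h10 : ‖ν‖ ^ 2 / x + x / 4 * t ^ 2 - ‖ν‖ * t = (‖ν‖ - x * t / 2) ^ 2 / x := by
          field_simp
          ring
        have h11 : 0 ≤ (‖ν‖ - x * t / 2) ^ 2 / x := by positivity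
        linarith
      nlinarith
    calc ‖besselKIntegrand ν x t‖
        = Real.exp (-x * Real.cosh t) * ‖Complex.cosh (ν * t)‖ := by
          rw [besselKIntegrand, norm_mul, Complex.norm_real,
            Real.norm_of_nonneg (Real.exp_pos _).le]
      _ ≤ Real.exp (-x * Real.cosh t) * Real.exp (‖ν‖ * t) := by gcongr
      _ = Real.exp (-x * Real.cosh t + ‖ν‖ * t) := (Real.exp_add _ _).symm
      _ ≤ Real.exp (‖ν‖ ^ 2 / x + -(x / 4) * t ^ 2) := Real.exp_le_exp.2 h8
      _ = _ := Real.exp_add _ _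

/-- A triple of spectral parameters of tempered type, in the closed dominant chamber:
`ν₀, ν₁, ν₂ ∈ i ℝ_{≥ 0}` and `ν₀ = ν₁ + ν₂`. -/
structure IsTemperedSpectralParameter (ν₀ ν₁ ν₂ : ℂ) : Prop where
  re_zero : ν₀.re = 0
  re_one : ν₁.re = 0
  re_two : ν₂.re = 0
  im_zero_nonneg : 0 ≤ ν₀.im
  im_one_nonneg : 0 ≤ ν₁.im
  im_two_nonneg : 0 ≤ ν₂.im
  sum_eq : ν₀ = ν₁ + ν₂

/-- `T₀ = max (2, |ν₀|, |ν₁|, |ν₂|)`. -/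
noncomputable def spectralSize (ν₀ ν₁ ν₂ : ℂ) : ℝ :=
  max 2 (max ‖ν₀‖ (max ‖ν₁‖ ‖ν₂‖))

/-- The Laplace eigenvalue `λ = 1 - 3 ν₁² - 3 ν₁ ν₂ - 3 ν₂²` attached to the spectral
parameters. -/
noncomputable def laplaceEigenvalue (ν₁ ν₂ : ℂ) : ℂ :=
  1 - 3 * ν₁ ^ 2 - 3 * ν₁ * ν₂ - 3 * ν₂ ^ 2

/-- The integrand (with respect to `du` on `(0, ∞)`) of the Vinogradov--Takhtadzhyan integral;
here `ν₀ = ν₁ + ν₂`. -/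
noncomputable def whittakerIntegrand (ν₁ ν₂ : ℂ) (y₁ y₂ u : ℝ) : ℂ :=
  besselK (3 / 2 * (ν₁ + ν₂)) (2 * Real.pi * y₁ * √(1 + u)) *
    besselK (3 / 2 * (ν₁ + ν₂)) (2 * Real.pi * y₂ * √(1 + u⁻¹)) *
    (u : ℂ) ^ (3 / 4 * (ν₁ - ν₂)) / (u : ℂ)

/-- The normalized diagonal `GL₃` Jacquet--Whittaker function `W̃_{ν₁,ν₂}(y₁, y₂)`;
here `ν₀ = ν₁ + ν₂`. -/
noncomputable def normalizedWhittaker (ν₁ ν₂ : ℂ) (y₁ y₂ : ℝ) : ℂ :=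
  ((4 * Real.pi ^ (3 / 2 : ℝ) *
      (‖Complex.Gamma (1 / 2 + 3 / 2 * (ν₁ + ν₂))‖⁻¹ *
        ‖Complex.Gamma (1 / 2 + 3 / 2 * ν₁)‖⁻¹ *
        ‖Complex.Gamma (1 / 2 + 3 / 2 * ν₂)‖⁻¹) * (y₁ * y₂) : ℝ) : ℂ) *
    ((y₁ / y₂ : ℝ) : ℂ) ^ ((ν₁ - ν₂) / 2) *
    ∫ u in Set.Ioi (0 : ℝ), whittakerIntegrand ν₁ ν₂ y₁ y₂ u

/-! Write `3/2 * ν₀ = r * I`. The powers of `u` and `y₁ / y₂` have imaginary exponents, so only the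
two Bessel factors and the Gamma factors matter. Cauchy–Schwarz in `du/u`, with `u = v²` for one
factor and `u = v⁻²` for the other, reduces the integral to the mean squares `∫ |K_{ir}(x√(1+v²))|²
dv` at `x = 2πy₁` and `x = 2πy₂`.

Since `K_{ir}` is real, the modulus squared is the square, a double exponential integral in `p, q`.
The `v, q` integrals are evaluated exactly in polar coordinates
(`integral_integral_exp_neg_mul_sqrt_mul_cosh`), leaving `π/(2x) ∫ exp(-2x cosh p + 2irp) / cosh p
dp` (`integrable_and_integral_besselK_sq`).

The line of integration is then raised to height `arccos T⁻¹`, about `1/T` below the pole at `iπ/2`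
(`norm_integral_exp_div_cosh_le`). As `r` is `O(T)`, stopping there loses only a constant from
`exp(-πr)`; the exponential in `x` still gives `exp(-2x/T)`, and the nearby pole costs `log T`. The
Gamma factors contribute at most a constant times `exp(πr)`, because `ν₀ = ν₁ + ν₂`, and this
cancels the gain exactly. Finally `exp(-2πy/T)` beats every power of `1 + y/T`. -/

/-! ### Contour shift and the logarithmic bound -/

open Filter Topology in
-- Cauchy's theorem on the rectangle `[-R, R] × [0, φ]`: each vertical side contributes at most `φ *
-- g R`, which tends to `0`.
theorem integral_eq_integral_add_mul_I {f : ℂ → ℂ} {φ : ℝ} (hφ : 0 ≤ φ)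
    (hf : ∀ z : ℂ, z.im ∈ Set.Icc 0 φ → DifferentiableAt ℂ f z) {g : ℝ → ℝ}
    (hg : Tendsto g atTop (𝓝 0))
    (hb : ∀ᶠ R in atTop, ∀ y ∈ Set.Icc 0 φ,
      ‖f ((R : ℝ) + y * Complex.I)‖ ≤ g R ∧ ‖f ((-R : ℝ) + y * Complex.I)‖ ≤ g R)
    (h0 : Integrable fun x : ℝ => f x) (h1 : Integrable fun x : ℝ => f (x + φ * Complex.I)) :
    ∫ x : ℝ, f x = ∫ x : ℝ, f (x + φ * Complex.I) := by
  have hrect (R : ℝ) : (∫ x : ℝ in (-R)..R, f x) - ∫ x : ℝ in (-R)..R, f (x + φ * Complex.I) =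
      Complex.I * (∫ y : ℝ in 0..φ, f ((-R : ℝ) + y * Complex.I)) -
        Complex.I * ∫ y : ℝ in 0..φ, f ((R : ℝ) + y * Complex.I) := by
    have h := Complex.integral_boundary_rect_eq_zero_of_differentiableOn f
      ((-R : ℝ) : ℂ) ((R : ℝ) + φ * Complex.I) (fun z hz => by
        refine (hf z ?_).differentiableWithinAt
        have := hz.2
        simpa [Set.uIcc_of_le hφ] using this)
    simp at h
    simp only [Complex.ofReal_neg]
    linear_combination h
  have hside (s : ℝ → ℝ) (hs : ∀ᶠ R in atTop, ∀ y ∈ Set.Icc 0 φ,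
      ‖f ((s R : ℝ) + y * Complex.I)‖ ≤ g R) :
      Tendsto (fun R => Complex.I * ∫ y : ℝ in 0..φ, f ((s R : ℝ) + y * Complex.I)) atTop
        (𝓝 0) := by
    refine squeeze_zero_norm' (a := fun R => g R * |φ - 0|) ?_ (by simpa using hg.mul_const _)
    filter_upwards [hs] with R hR
    rw [norm_mul, Complex.norm_I, one_mul]
    refine intervalIntegral.norm_integral_le_of_norm_le_const fun y hy => hR y ?_
    rw [Set.uIoc_of_le hφ] at hy
    exact ⟨hy.1.le, hy.2⟩
  have hlim := (hside (fun R => -R) (hb.mono fun R h y hy => (h y hy).2)).sub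
    (hside (fun R => R) (hb.mono fun R h y hy => (h y hy).1))
  have hlim' := (intervalIntegral_tendsto_integral h0 tendsto_neg_atTop_atBot tendsto_id).sub
    (intervalIntegral_tendsto_integral h1 tendsto_neg_atTop_atBot tendsto_id)
  rw [sub_zero] at hlim
  refine sub_eq_zero.1 (tendsto_nhds_unique hlim' (hlim.congr fun R => ?_))
  exact (hrect R).symm

theorem one_add_sq_div_two_le_cosh (t : ℝ) : 1 + t ^ 2 / 2 ≤ Real.cosh t := by
  have h1 : Real.cosh t = 1 + 2 * Real.sinh (t / 2) ^ 2 := by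
    have h2 := Real.cosh_two_mul (t / 2)
    have h3 := Real.cosh_sq (t / 2)
    rw [show 2 * (t / 2) = t by ring] at h2
    linarith
  have h4 : (t / 2) ^ 2 ≤ Real.sinh (t / 2) ^ 2 := by
    rcases le_total 0 t with h | h
    · exact pow_le_pow_left₀ (by positivity) (Real.self_le_sinh_iff.2 (by positivity)) 2
    · nlinarith [Real.sinh_le_self_iff.2 (show t / 2 ≤ 0 by linarith)]
  nlinarith

/-- A rational majorant with an elementary antiderivative: it behaves like `1/(p + ε)` near `0`, the
source of the logarithm, and is integrable at infinity. It rests on `sinh² p ≥ p² + p⁴/4`. -/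
theorem inv_sqrt_sinh_sq_add_sq_le {ε p : ℝ} (hε : 0 < ε) (hε1 : ε ≤ 1) (hp : 0 < p) :
    (√(Real.sinh p ^ 2 + ε ^ 2))⁻¹ ≤ 4 * ((p + ε) * (1 + p))⁻¹ := by
  have h1 := one_add_sq_div_two_le_cosh p
  have h2 : p ^ 2 + p ^ 4 / 4 ≤ Real.sinh p ^ 2 := by
    nlinarith [Real.cosh_sq p, sq_nonneg p]
  have h3 : (p + ε) * (1 + p) / 4 ≤ √(Real.sinh p ^ 2 + ε ^ 2) := by
    refine Real.le_sqrt_of_sq_le ?_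
    have h4 : ε ^ 2 * p ^ 2 ≤ p ^ 2 := by
      have : ε ^ 2 ≤ 1 := by nlinarith
      nlinarith [sq_nonneg p]
    have h5 : (p + ε) ^ 2 ≤ 2 * (p ^ 2 + ε ^ 2) := by nlinarith [sq_nonneg (p - ε)]
    have h6 : (1 + p) ^ 2 ≤ 2 * (1 + p ^ 2) := by nlinarith [sq_nonneg (p - 1)]
    have h7 := mul_le_mul h5 h6 (by positivity) (by positivity)
    nlinarith
  calc _ ≤ ((p + ε) * (1 + p) / 4)⁻¹ := inv_anti₀ (by positivity) h3
    _ = _ := by rw [inv_div, div_eq_mul_inv]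

theorem integrable_of_even_of_integrableOn_Ioi {E : Type*} [NormedAddCommGroup E] {f : ℝ → E}
    (hf : ∀ x, f (-x) = f x) (h : IntegrableOn f (Set.Ioi 0)) : Integrable f := by
  rw [← integrableOn_univ, ← Set.Iic_union_Ioi (a := (0 : ℝ))]
  refine IntegrableOn.union ?_ h
  rw [← Measure.map_neg_eq_self (volume : Measure ℝ)]
  let m : MeasurableEmbedding fun x : ℝ => -x := (Homeomorph.neg ℝ).measurableEmbedding
  rw [m.integrableOn_map_iff]
  simpa [Function.comp_def, hf, integrableOn_Ici_iff_integrableOn_Ioi] using h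

open Filter Topology in
theorem integrable_and_integral_inv_sqrt_sinh_sq_add_sq_le {T : ℝ} (hT : 2 ≤ T) :
    Integrable (fun p : ℝ => (√(Real.sinh p ^ 2 + T⁻¹ ^ 2))⁻¹) ∧
      ∫ p : ℝ, (√(Real.sinh p ^ 2 + T⁻¹ ^ 2))⁻¹ ≤ 16 * Real.log T := by
  set ε := T⁻¹ with hε
  have hε0 : 0 < ε := by positivity
  have hε2 : ε ≤ 1 / 2 := by rw [hε, one_div]; exact inv_anti₀ (by norm_num) hT
  -- Partial fractions; `T ≥ 2` keeps `(1 - ε)⁻¹ ≤ 2`. The final `16` is `2` (evenness) times `4`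
  -- (majorant) times this `2`.
  set G : ℝ → ℝ := fun p => (1 - ε)⁻¹ * (Real.log (p + ε) - Real.log (1 + p)) with hG
  have hderiv : ∀ p ∈ Set.Ici (0 : ℝ), HasDerivAt G (((p + ε) * (1 + p))⁻¹) p := by
    intro p hp
    have hp' : 0 ≤ p := hp
    have h1 : p + ε ≠ 0 := by positivity
    have h2 : 1 + p ≠ 0 := by positivity
    have h3 : 1 - ε ≠ 0 := by linarith
    have := ((((hasDerivAt_id p).add_const ε).log h1).sub
      (((hasDerivAt_id p).const_add 1).log h2)).const_mul (1 - ε)⁻¹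
    refine HasDerivAt.congr_deriv (f := G) this ?_
    simp only [id]
    field_simp
    ring
  have hnn : ∀ p ∈ Set.Ioi (0 : ℝ), 0 ≤ ((p + ε) * (1 + p))⁻¹ := fun p hp => by
    have hp' : 0 < p := hp
    positivity
  have hlim : Tendsto G atTop (𝓝 0) := by
    have h1 : Tendsto (fun p : ℝ => (p + ε) / (1 + p)) atTop (𝓝 1) := by
      have h2 : Tendsto (fun p : ℝ => 1 - (1 - ε) * (1 + p)⁻¹) atTop (𝓝 (1 - (1 - ε) * 0)) :=
        (((tendsto_atTop_add_const_left _ _ tendsto_id).inv_tendsto_atTop).const_mul _).const_sub _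
      rw [mul_zero, sub_zero] at h2
      refine h2.congr' ?_
      filter_upwards [eventually_gt_atTop 0] with p hp
      field_simp
      ring
    have h3 := (h1.log one_ne_zero).const_mul (1 - ε)⁻¹
    rw [Real.log_one, mul_zero] at h3
    refine h3.congr' ?_
    filter_upwards [eventually_gt_atTop 0] with p hp
    rw [Real.log_div (by positivity) (by positivity)]
  have hint := integrableOn_Ioi_deriv_of_nonneg' hderiv hnn hlim
  have hval := integral_Ioi_of_hasDerivAt_of_nonneg' hderiv hnn hlim
  have hmeas : Continuous fun p : ℝ => (√(Real.sinh p ^ 2 + ε ^ 2))⁻¹ := by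
    refine Continuous.inv₀ (by fun_prop) fun p => ?_
    positivity
  have hIoi : IntegrableOn (fun p : ℝ => (√(Real.sinh p ^ 2 + ε ^ 2))⁻¹) (Set.Ioi 0) := by
    refine Integrable.mono' (hint.const_mul 4) hmeas.aestronglyMeasurable ?_
    filter_upwards [ae_restrict_mem measurableSet_Ioi] with p hp
    rw [Real.norm_of_nonneg (by positivity)]
    exact inv_sqrt_sinh_sq_add_sq_le hε0 (by linarith) hp
  have habs (p : ℝ) : (√(Real.sinh |p| ^ 2 + ε ^ 2))⁻¹ = (√(Real.sinh p ^ 2 + ε ^ 2))⁻¹ := by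
    rcases abs_choice p with h | h <;> rw [h]
    rw [Real.sinh_neg, neg_sq]
  constructor
  · exact integrable_of_even_of_integrableOn_Ioi (fun p => by simp) hIoi
  · have h := integral_comp_abs (f := fun p : ℝ => (√(Real.sinh p ^ 2 + ε ^ 2))⁻¹)
    simp only [habs] at h
    rw [h]
    have h2 : ∫ p in Set.Ioi (0 : ℝ), (√(Real.sinh p ^ 2 + ε ^ 2))⁻¹ ≤
        ∫ p in Set.Ioi (0 : ℝ), 4 * ((p + ε) * (1 + p))⁻¹ :=
      setIntegral_mono_on hIoi (hint.const_mul 4) measurableSet_Ioi fun p hp =>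
        inv_sqrt_sinh_sq_add_sq_le hε0 (by linarith) hp
    rw [integral_const_mul, hval] at h2
    have h3 : (1 - ε)⁻¹ ≤ 2 := by
      rw [inv_le_comm₀ (by linarith) (by norm_num)]
      linarith
    have h4 : 0 ≤ Real.log T := Real.log_nonneg (by linarith)
    have h5 : 0 - G 0 = (1 - ε)⁻¹ * Real.log T := by
      simp only [hG, zero_add, add_zero, Real.log_one, hε, Real.log_inv]
      ring
    rw [h5] at h2
    nlinarith [mul_le_mul_of_nonneg_right h3 h4]

theorem re_cosh_add_mul_I (p y : ℝ) :
    (Complex.cosh (p + y * Complex.I)).re = Real.cosh p * Real.cos y := by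
  rw [Complex.cosh_add, Complex.cosh_mul_I, Complex.sinh_mul_I, ← Complex.ofReal_cosh,
    ← Complex.ofReal_sinh, ← Complex.ofReal_cos, ← Complex.ofReal_sin]
  simp [-Complex.ofReal_cosh, -Complex.ofReal_sinh, -Complex.ofReal_cos, -Complex.ofReal_sin]

theorem norm_cosh_add_mul_I (p y : ℝ) :
    ‖Complex.cosh (p + y * Complex.I)‖ = √(Real.sinh p ^ 2 + Real.cos y ^ 2) := by
  rw [Complex.cosh_add, Complex.cosh_mul_I, Complex.sinh_mul_I, ← Complex.ofReal_cosh,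
    ← Complex.ofReal_sinh, ← Complex.ofReal_cos, ← Complex.ofReal_sin,
    Complex.norm_eq_sqrt_sq_add_sq]
  congr 1
  simp [-Complex.ofReal_cosh, -Complex.ofReal_sinh, -Complex.ofReal_cos, -Complex.ofReal_sin]
  nlinarith [Real.cosh_sq p, Real.sin_sq_add_cos_sq y]

theorem norm_exp_div_cosh_add_mul_I (r x p y : ℝ) :
    ‖Complex.exp (-2 * x * Complex.cosh (p + y * Complex.I) +
        2 * r * Complex.I * (p + y * Complex.I)) / Complex.cosh (p + y * Complex.I)‖ =
      Real.exp (-2 * x * (Real.cosh p * Real.cos y) - 2 * r * y) *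
        (√(Real.sinh p ^ 2 + Real.cos y ^ 2))⁻¹ := by
  rw [norm_div, norm_cosh_add_mul_I, Complex.norm_exp, div_eq_mul_inv]
  congr 2
  rw [← re_cosh_add_mul_I]
  simp
  ring

theorem cosh_add_mul_I_ne_zero {p y : ℝ} (hy : 0 < Real.cos y) :
    Complex.cosh (p + y * Complex.I) ≠ 0 := by
  intro h
  have := re_cosh_add_mul_I p y
  rw [h, Complex.zero_re] at this
  have := mul_pos (Real.cosh_pos p) hy
  linarith

open Filter Topology in
/-- Moving the line of integration up to `Im = arccos T⁻¹` captures the decay in `r`. -/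
theorem norm_integral_exp_div_cosh_le {r x T : ℝ} (hr : 0 ≤ r) (hx : 0 < x) (hT : 2 ≤ T) :
    ‖∫ p : ℝ, Complex.exp (-2 * x * Complex.cosh p + 2 * r * Complex.I * p) / Complex.cosh p‖ ≤
      Real.exp (-2 * r * Real.arccos T⁻¹) * Real.exp (-2 * x / T) * (16 * Real.log T) := by
  set φ := Real.arccos T⁻¹ with hφ
  have hTinv : 0 < T⁻¹ := by positivity
  have hTinv1 : T⁻¹ ≤ 1 := inv_le_one_of_one_le₀ (by linarith)
  have hcosφ : Real.cos φ = T⁻¹ := Real.cos_arccos (by linarith) hTinv1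
  have hφ0 : 0 ≤ φ := Real.arccos_nonneg _
  have hφ1 : φ < Real.pi / 2 := Real.arccos_lt_pi_div_two.2 hTinv
  have hcos {y : ℝ} (hy : y ∈ Set.Icc 0 φ) : 0 < Real.cos y :=
    Real.cos_pos_of_mem_Ioo ⟨by linarith [hy.1, Real.pi_pos], by linarith [hy.2]⟩
  obtain ⟨hint, hval⟩ := integrable_and_integral_inv_sqrt_sinh_sq_add_sq_le hT
  set f : ℂ → ℂ := fun z => Complex.exp (-2 * x * Complex.cosh z + 2 * r * Complex.I * z) /
    Complex.cosh z with hf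
  have hdiff : ∀ z : ℂ, z.im ∈ Set.Icc 0 φ → DifferentiableAt ℂ f z := by
    intro z hz
    have h := cosh_add_mul_I_ne_zero (p := z.re) (hcos hz)
    rw [Complex.re_add_im] at h
    have h2 : DifferentiableAt ℂ Complex.cosh z := Complex.differentiable_cosh z
    exact DifferentiableAt.div (by fun_prop) h2 h
  have hcont {y : ℝ} (hy : y ∈ Set.Icc 0 φ) : Continuous fun p : ℝ => f (p + y * Complex.I) := by
    refine continuous_iff_continuousAt.2 fun p => ?_
    refine ContinuousAt.comp (f := fun p : ℝ => (p : ℂ) + y * Complex.I)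
      (hdiff _ (by simpa using hy)).continuousAt (by fun_prop)
  have hnorm {y : ℝ} (hy : y ∈ Set.Icc 0 φ) (p : ℝ) : ‖f (p + y * Complex.I)‖ ≤
      Real.exp (-2 * x * Real.cos y - 2 * r * y) * (√(Real.sinh p ^ 2 + Real.cos y ^ 2))⁻¹ := by
    rw [hf, norm_exp_div_cosh_add_mul_I]
    have h1 : Real.cos y ≤ Real.cosh p * Real.cos y :=
      le_mul_of_one_le_left (hcos hy).le (Real.one_le_cosh p)
    gcongr ?_ * _
    refine Real.exp_le_exp.2 ?_
    nlinarith
  have hcosle {y : ℝ} (hy : y ∈ Set.Icc 0 φ) : T⁻¹ ≤ Real.cos y := by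
    rw [← hcosφ]
    exact Real.cos_le_cos_of_nonneg_of_le_pi hy.1 (by linarith [Real.pi_pos]) hy.2
  have hle {y : ℝ} (hy : y ∈ Set.Icc 0 φ) (p : ℝ) : (√(Real.sinh p ^ 2 + Real.cos y ^ 2))⁻¹ ≤
      (√(Real.sinh p ^ 2 + T⁻¹ ^ 2))⁻¹ := by
    have := hcosle hy
    gcongr
  have hintf {y : ℝ} (hy : y ∈ Set.Icc 0 φ) : Integrable fun p : ℝ => f (p + y * Complex.I) := by
    refine Integrable.mono' (hint.const_mul (Real.exp (-2 * x * Real.cos y - 2 * r * y)))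
      (hcont hy).aestronglyMeasurable (ae_of_all _ fun p => (hnorm hy p).trans ?_)
    gcongr
    exact hcosle hy
  have hshift : ∫ p : ℝ, f p = ∫ p : ℝ, f (p + φ * Complex.I) := by
    -- On the vertical sides the exponential has modulus at most `1` and `|cosh| ≥ sinh R`.
    have hg : Tendsto (fun R : ℝ => (Real.sinh R)⁻¹) atTop (𝓝 0) :=
      (tendsto_atTop_mono' atTop ((eventually_ge_atTop 0).mono fun R hR =>
        Real.self_le_sinh_iff.2 hR) tendsto_id).inv_tendsto_atTop
    refine integral_eq_integral_add_mul_I hφ0 hdiff hg ?_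
      (by simpa using hintf ⟨le_rfl, hφ0⟩) (hintf ⟨hφ0, le_rfl⟩)
    filter_upwards [eventually_gt_atTop 0] with R hR y hy
    have key (s : ℝ) (hs : Real.sinh s ^ 2 = Real.sinh R ^ 2) :
        ‖f ((s : ℝ) + y * Complex.I)‖ ≤ (Real.sinh R)⁻¹ := by
      refine (hnorm hy s).trans ?_
      have h1 : Real.exp (-2 * x * Real.cos y - 2 * r * y) ≤ 1 := by
        rw [Real.exp_le_one_iff]
        nlinarith [mul_pos hx (hcos hy), mul_nonneg hr hy.1]
      have h2 : (√(Real.sinh s ^ 2 + Real.cos y ^ 2))⁻¹ ≤ (Real.sinh R)⁻¹ := by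
        refine inv_anti₀ (Real.sinh_pos_iff.2 hR) (Real.le_sqrt_of_sq_le ?_)
        rw [hs]
        nlinarith [sq_nonneg (Real.cos y)]
      calc _ ≤ 1 * (√(Real.sinh s ^ 2 + Real.cos y ^ 2))⁻¹ := by gcongr
        _ ≤ _ := by rwa [one_mul]
    exact ⟨key R rfl, key (-R) (by simp)⟩
  have hφmem : φ ∈ Set.Icc 0 φ := ⟨hφ0, le_rfl⟩
  change ‖∫ p : ℝ, f p‖ ≤ _
  rw [hshift]
  calc ‖∫ p : ℝ, f (p + φ * Complex.I)‖ ≤ ∫ p : ℝ,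
        Real.exp (-2 * x * Real.cos φ - 2 * r * φ) * (√(Real.sinh p ^ 2 + T⁻¹ ^ 2))⁻¹ :=
        norm_integral_le_of_norm_le (hint.const_mul _) (ae_of_all _ fun p => by
          have := hnorm hφmem p
          rwa [hcosφ] at this ⊢)
    _ ≤ Real.exp (-2 * x * Real.cos φ - 2 * r * φ) * (16 * Real.log T) := by
        rw [integral_const_mul]
        gcongr
    _ = _ := by
        rw [← Real.exp_add, hcosφ]
        congr 2
        ring

/-- The height falls short of `π/2` by `arcsin T⁻¹`, which Jordan's inequality bounds by `π/(2T)`;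
with `r ≤ 3T/2` the loss is a constant factor. -/
theorem exp_neg_two_mul_arccos_inv_le {r T : ℝ} (hr : r ≤ 3 / 2 * T) (hT : 2 ≤ T) :
    Real.exp (-2 * r * Real.arccos T⁻¹) ≤
      Real.exp (3 / 2 * Real.pi) * Real.exp (-(Real.pi * r)) := by
  have hTinv : 0 < T⁻¹ := by positivity
  have hTinv1 : T⁻¹ ≤ 1 := inv_le_one_of_one_le₀ (by linarith)
  have h1 := Real.mul_le_sin (Real.arcsin_nonneg.2 hTinv.le) (Real.arcsin_le_pi_div_two T⁻¹)
  rw [Real.sin_arcsin (by linarith) hTinv1] at h1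
  have h2 : Real.arcsin T⁻¹ ≤ Real.pi / 2 * T⁻¹ := by
    have h3 := mul_le_mul_of_nonneg_left h1 (by positivity : 0 ≤ Real.pi / 2)
    have h4 : Real.pi / 2 * (2 / Real.pi * Real.arcsin T⁻¹) = Real.arcsin T⁻¹ := by
      field_simp
    linarith
  have h5 : r * Real.arcsin T⁻¹ ≤ 3 / 4 * Real.pi := by
    calc r * Real.arcsin T⁻¹ ≤ 3 / 2 * T * (Real.pi / 2 * T⁻¹) :=
          mul_le_mul hr h2 (Real.arcsin_nonneg.2 hTinv.le) (by positivity)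
      _ = _ := by field_simp; norm_num
  rw [← Real.exp_add, Real.exp_le_exp, Real.arccos]
  linarith

/-! ### An exact planar integral -/

theorem integrable_exp_neg_mul_cosh {c : ℝ} (hc : 0 < c) :
    Integrable fun q : ℝ => Real.exp (-c * Real.cosh q) := by
  refine Integrable.mono' (integrable_exp_neg_mul_sq (half_pos hc))
    (by fun_prop) (ae_of_all _ fun q => ?_)
  rw [Real.norm_of_nonneg (Real.exp_pos _).le, Real.exp_le_exp]
  nlinarith [one_add_sq_div_two_le_cosh q]

theorem integrable_exp_neg_mul_sqrt_one_add_sq {c : ℝ} (hc : 0 < c) :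
    Integrable fun v : ℝ => Real.exp (-c * √(1 + v ^ 2)) := by
  refine Integrable.mono' (integrable_inv_one_add_sq.const_mul (2 / c ^ 2))
    (by fun_prop) (ae_of_all _ fun v => ?_)
  rw [Real.norm_of_nonneg (Real.exp_pos _).le, neg_mul, Real.exp_neg]
  have h1 : 0 < √(1 + v ^ 2) := by positivity
  have h2 := Real.quadratic_le_exp_of_nonneg (mul_pos hc h1).le
  have h3 : √(1 + v ^ 2) ^ 2 = 1 + v ^ 2 := Real.sq_sqrt (by positivity)
  have h4 : c ^ 2 / 2 * (1 + v ^ 2) ≤ Real.exp (c * √(1 + v ^ 2)) := by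
    have := mul_pos hc h1
    rw [mul_pow, h3] at h2
    linarith
  calc _ ≤ (c ^ 2 / 2 * (1 + v ^ 2))⁻¹ := inv_anti₀ (by positivity) h4
    _ = _ := by rw [mul_inv, inv_div]

/-- Substitution `X = a sinh q`. With `a = √(1 + v²)` the integrand becomes radial in `(v, X)`. -/
theorem integral_exp_neg_mul_cosh_eq {a : ℝ} (ha : 0 < a) (c : ℝ) :
    ∫ q : ℝ, Real.exp (-c * (a * Real.cosh q)) =
      ∫ X : ℝ, (√(a ^ 2 + X ^ 2))⁻¹ * Real.exp (-c * √(a ^ 2 + X ^ 2)) := by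
  have himg : (fun q : ℝ => a * Real.sinh q) '' Set.univ = Set.univ := by
    refine Set.eq_univ_of_forall fun X => ⟨Real.arsinh (X / a), trivial, ?_⟩
    simp only [Real.sinh_arsinh]
    field_simp
  have h := integral_image_eq_integral_abs_deriv_smul (s := Set.univ)
    (f := fun q : ℝ => a * Real.sinh q) (f' := fun q => a * Real.cosh q) MeasurableSet.univ
    (fun q _ => ((Real.hasDerivAt_sinh q).const_mul a).hasDerivWithinAt)
    (fun p _ q _ h => Real.sinh_injective (mul_left_cancel₀ ha.ne' h))
    (fun X : ℝ => (√(a ^ 2 + X ^ 2))⁻¹ * Real.exp (-c * √(a ^ 2 + X ^ 2)))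
  rw [himg, Measure.restrict_univ] at h
  rw [h]
  refine integral_congr_ae (ae_of_all _ fun q => ?_)
  have h1 : 0 < a * Real.cosh q := mul_pos ha (Real.cosh_pos q)
  have h2 : √(a ^ 2 + (a * Real.sinh q) ^ 2) = a * Real.cosh q := by
    rw [show a ^ 2 + (a * Real.sinh q) ^ 2 = (a * Real.cosh q) ^ 2 by
      rw [mul_pow, mul_pow, Real.cosh_sq]; ring, Real.sqrt_sq h1.le]
  simp only [h2, smul_eq_mul, abs_of_pos h1]
  field_simp

open Filter Topology in
theorem integral_Ioi_mul_exp_neg_mul_sqrt {c : ℝ} (hc : 0 < c) :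
    ∫ ρ in Set.Ioi (0 : ℝ), ρ * ((√(1 + ρ ^ 2))⁻¹ * Real.exp (-c * √(1 + ρ ^ 2))) =
      Real.exp (-c) / c := by
  have hderiv : ∀ ρ ∈ Set.Ici (0 : ℝ), HasDerivAt
      (fun ρ : ℝ => -(c⁻¹ * Real.exp (-c * √(1 + ρ ^ 2))))
      (ρ * ((√(1 + ρ ^ 2))⁻¹ * Real.exp (-c * √(1 + ρ ^ 2)))) ρ := by
    intro ρ _
    have h1 : HasDerivAt (fun ρ : ℝ => 1 + ρ ^ 2) (2 * ρ) ρ := by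
      simpa using (hasDerivAt_pow 2 ρ).const_add 1
    have h2 := (((h1.sqrt (by positivity)).const_mul (-c)).exp.const_mul c⁻¹).neg
    refine h2.congr_deriv ?_
    field_simp
  have hlim : Tendsto (fun ρ : ℝ => -(c⁻¹ * Real.exp (-c * √(1 + ρ ^ 2)))) atTop (𝓝 0) := by
    have h1 : Tendsto (fun ρ : ℝ => √(1 + ρ ^ 2)) atTop atTop :=
      tendsto_atTop_mono (fun ρ => Real.le_sqrt_of_sq_le (by simp)) tendsto_id
    have h2 := Real.tendsto_exp_atBot.comp (h1.const_mul_atTop_of_neg (neg_lt_zero.2 hc))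
    simpa using (h2.const_mul c⁻¹).neg
  rw [integral_Ioi_of_hasDerivAt_of_nonneg' hderiv (fun ρ hρ => by
    have hρ' : 0 < ρ := hρ
    positivity) hlim]
  simp
  field_simp

theorem integral_integral_exp_neg_mul_sqrt_mul_cosh {c : ℝ} (hc : 0 < c) :
    ∫ v : ℝ, ∫ q : ℝ, Real.exp (-c * (√(1 + v ^ 2) * Real.cosh q)) =
      2 * Real.pi * (Real.exp (-c) / c) := by
  set g : ℝ × ℝ → ℝ := fun z =>
    (√(1 + z.1 ^ 2 + z.2 ^ 2))⁻¹ * Real.exp (-c * √(1 + z.1 ^ 2 + z.2 ^ 2)) with hg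
  have hgint : Integrable g := by
    -- The root dominates both `√(1 + v²)` and `√(1 + X²)`, so half of `c` is spent on each
    -- variable.
    have hb := (integrable_exp_neg_mul_sqrt_one_add_sq (half_pos hc)).mul_prod
      (integrable_exp_neg_mul_sqrt_one_add_sq (half_pos hc))
    refine Integrable.mono' hb (Continuous.aestronglyMeasurable ?_) (ae_of_all _ fun z => ?_)
    · refine Continuous.mul (Continuous.inv₀ (by fun_prop) fun z => ?_) (by fun_prop)
      positivity
    · rw [Real.norm_of_nonneg (by positivity), ← Real.exp_add]
      have h1 : √(1 + z.1 ^ 2) ≤ √(1 + z.1 ^ 2 + z.2 ^ 2) :=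
        Real.sqrt_le_sqrt (by nlinarith [sq_nonneg z.2])
      have h2 : √(1 + z.2 ^ 2) ≤ √(1 + z.1 ^ 2 + z.2 ^ 2) :=
        Real.sqrt_le_sqrt (by nlinarith [sq_nonneg z.1])
      have h3 : 1 ≤ √(1 + z.1 ^ 2 + z.2 ^ 2) := by
        rw [Real.one_le_sqrt]
        nlinarith [sq_nonneg z.1, sq_nonneg z.2]
      calc _ ≤ 1 * Real.exp (-c * √(1 + z.1 ^ 2 + z.2 ^ 2)) :=
            mul_le_mul_of_nonneg_right (inv_le_one_of_one_le₀ h3) (Real.exp_pos _).le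
        _ ≤ _ := by
            rw [one_mul, Real.exp_le_exp]
            nlinarith
  calc ∫ v : ℝ, ∫ q : ℝ, Real.exp (-c * (√(1 + v ^ 2) * Real.cosh q))
      = ∫ v : ℝ, ∫ X : ℝ, g (v, X) := by
        refine integral_congr_ae (ae_of_all _ fun v => ?_)
        simp only [integral_exp_neg_mul_cosh_eq (show 0 < √(1 + v ^ 2) by positivity) c, hg,
          Real.sq_sqrt (show 0 ≤ 1 + v ^ 2 by positivity)]
    _ = ∫ z : ℝ × ℝ, g z := (integral_prod g hgint).symm
    _ = ∫ z in Set.Ioi (0 : ℝ) ×ˢ Set.Ioo (-Real.pi) Real.pi,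
          z.1 * ((√(1 + z.1 ^ 2))⁻¹ * Real.exp (-c * √(1 + z.1 ^ 2))) * 1 := by
        rw [← integral_comp_polarCoord_symm, polarCoord_target]
        refine integral_congr_ae (ae_of_all _ fun z => ?_)
        simp only [polarCoord_symm_apply, hg, smul_eq_mul, mul_one]
        rw [show 1 + (z.1 * Real.cos z.2) ^ 2 + (z.1 * Real.sin z.2) ^ 2 = 1 + z.1 ^ 2 by
          linear_combination z.1 ^ 2 * Real.sin_sq_add_cos_sq z.2]
    _ = _ := by
        rw [Measure.volume_eq_prod, setIntegral_prod_mul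
          (fun ρ : ℝ => ρ * ((√(1 + ρ ^ 2))⁻¹ * Real.exp (-c * √(1 + ρ ^ 2)))) (fun _ => (1 : ℝ)),
          integral_Ioi_mul_exp_neg_mul_sqrt hc]
        simp [Real.pi_pos.le]
        ring

/-! ### The square of the Bessel function and its mean value -/

theorem integrable_cexp_neg_mul_cosh_add {c : ℝ} (hc : 0 < c) (r : ℝ) :
    Integrable fun t : ℝ => Complex.exp (-c * Real.cosh t + r * Complex.I * t) := by
  refine (integrable_exp_neg_mul_cosh hc).mono' (by fun_prop) (ae_of_all _ fun t => le_of_eq ?_)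
  rw [Complex.norm_exp]
  congr 1
  simp [-Complex.ofReal_cosh]

theorem besselK_mul_I_eq_half_integral (r : ℝ) {z : ℝ} (hz : 0 < z) :
    besselK (r * Complex.I) z =
      1 / 2 * ∫ t : ℝ, Complex.exp (-z * Real.cosh t + r * Complex.I * t) := by
  have hint := integrable_cexp_neg_mul_cosh_add hz r
  have hint' := integrable_cexp_neg_mul_cosh_add hz (-r)
  have h1 : ∫ t in Set.Iic (0 : ℝ), Complex.exp (-z * Real.cosh t + r * Complex.I * t) =
      ∫ t in Set.Ioi (0 : ℝ), Complex.exp (-z * Real.cosh t + (-r : ℝ) * Complex.I * t) := by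
    rw [← neg_zero, ← integral_comp_neg_Ioi, neg_zero]
    simp
  rw [← integral_add_compl measurableSet_Iic hint, Set.compl_Iic, h1,
    ← integral_add hint'.integrableOn hint.integrableOn, ← integral_const_mul, besselK]
  refine integral_congr_ae (ae_of_all _ fun t => ?_)
  simp only [besselKIntegrand, Complex.cosh, Complex.ofReal_exp, Complex.exp_add]
  push_cast
  simp only [Complex.cosh, neg_mul]
  ring

/-- The square of an integral is the integral of a self-convolution. In the variables `p ± q` one
has `cosh (p + q) + cosh (p - q) = 2 cosh p cosh q`, and the phase depends on `p` alone. The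
Jacobian `2` turns `1/4` into `1/2`. -/
theorem besselK_mul_I_sq (r : ℝ) {z : ℝ} (hz : 0 < z) :
    besselK (r * Complex.I) z ^ 2 = 1 / 2 * ∫ p : ℝ, ∫ q : ℝ,
      Complex.exp (2 * r * Complex.I * p) *
        (Real.exp (-2 * z * (Real.cosh p * Real.cosh q)) : ℝ) := by
  have hint := integrable_cexp_neg_mul_cosh_add hz r
  set f : ℝ → ℂ := fun t => Complex.exp (-z * Real.cosh t + r * Complex.I * t) with hf
  have hconv := integral_convolution (ContinuousLinearMap.mul ℂ ℂ) hint hint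
  have hscale := Measure.integral_comp_mul_left
    (fun P => convolution f f (ContinuousLinearMap.mul ℂ ℂ) volume P) 2
  rw [hconv] at hscale
  have hinner (p : ℝ) : convolution f f (ContinuousLinearMap.mul ℂ ℂ) volume (2 * p) =
      ∫ q : ℝ, Complex.exp (2 * r * Complex.I * p) *
        (Real.exp (-2 * z * (Real.cosh p * Real.cosh q)) : ℝ) := by
    rw [convolution, ← integral_add_left_eq_self _ p]
    refine integral_congr_ae (ae_of_all _ fun q => ?_)
    simp only [ContinuousLinearMap.mul_apply', hf, Complex.ofReal_exp, ← Complex.exp_add]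
    congr 1
    rw [show 2 * p - (p + q) = p - q by ring, Real.cosh_add, Real.cosh_sub]
    push_cast
    ring
  simp only [hinner] at hscale
  rw [hscale, besselK_mul_I_eq_half_integral r hz]
  simp [hf]
  ring

theorem besselK_mul_I_eq_ofReal (r z : ℝ) :
    besselK (r * Complex.I) z =
      ((∫ t in Set.Ioi (0 : ℝ), Real.exp (-z * Real.cosh t) * Real.cos (r * t) : ℝ) : ℂ) := by
  rw [besselK, ← integral_complex_ofReal]
  refine integral_congr_ae (ae_of_all _ fun t => ?_)
  simp only [besselKIntegrand]
  rw [show (r : ℂ) * Complex.I * t = ((r * t : ℝ) : ℂ) * Complex.I by push_cast; ring,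
    Complex.cosh_mul_I]
  push_cast
  rfl

/-- Reality of `K_{ir}` trades the modulus for the square, whose integral representation keeps the
phase `exp(2irp)` that the contour shift exploits. -/
theorem ofReal_norm_besselK_mul_I_sq (r z : ℝ) :
    ((‖besselK (r * Complex.I) z‖ ^ 2 : ℝ) : ℂ) = besselK (r * Complex.I) z ^ 2 := by
  rw [besselK_mul_I_eq_ofReal, Complex.norm_real, Real.norm_eq_abs, sq_abs]
  push_cast
  rfl

/-- Separates the variables in the exponent, so that the triple integrand has a product majorant and
Fubini applies. -/
theorem add_add_le_three_mul {a b c : ℝ} (ha : 1 ≤ a) (hb : 1 ≤ b) (hc : 1 ≤ c) :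
    a + b + c ≤ 3 * (a * (b * c)) := by
  have h1 : 1 ≤ b * c := one_le_mul_of_one_le_of_one_le hb hc
  have h2 : b ≤ b * c := le_mul_of_one_le_right (by linarith) hc
  have h3 : c ≤ b * c := le_mul_of_one_le_left (by linarith) hb
  have h4 : a ≤ a * (b * c) := le_mul_of_one_le_right (by linarith) h1
  have h5 : b * c ≤ a * (b * c) := le_mul_of_one_le_left (by linarith) ha
  linarith

theorem integrable_cexp_mul_exp_neg_mul_sqrt_mul_cosh_mul_cosh (r : ℝ) {x : ℝ} (hx : 0 < x) :
    Integrable fun z : (ℝ × ℝ) × ℝ => Complex.exp (2 * r * Complex.I * z.1.2) *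
      (Real.exp (-2 * (x * √(1 + z.1.1 ^ 2)) * (Real.cosh z.1.2 * Real.cosh z.2)) : ℝ) := by
  have hx' : 0 < 2 * x / 3 := by positivity
  have hb := ((integrable_exp_neg_mul_sqrt_one_add_sq hx').mul_prod
    (integrable_exp_neg_mul_cosh hx')).mul_prod (integrable_exp_neg_mul_cosh hx')
  refine Integrable.mono' hb (Continuous.aestronglyMeasurable (by fun_prop))
    (ae_of_all _ fun z => ?_)
  have h0 : ‖Complex.exp (2 * r * Complex.I * z.1.2)‖ = 1 := by
    rw [show 2 * (r : ℂ) * Complex.I * z.1.2 = ((2 * r * z.1.2 : ℝ) : ℂ) * Complex.I by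
      push_cast; ring, Complex.norm_exp_ofReal_mul_I]
  rw [norm_mul, h0, one_mul, Complex.norm_real, Real.norm_of_nonneg (Real.exp_pos _).le,
    ← Real.exp_add, ← Real.exp_add, Real.exp_le_exp]
  have h1 : 1 ≤ √(1 + z.1.1 ^ 2) := by
    rw [Real.one_le_sqrt]
    nlinarith [sq_nonneg z.1.1]
  have h2 := add_add_le_three_mul h1 (Real.one_le_cosh z.1.2) (Real.one_le_cosh z.2)
  nlinarith

theorem integrable_and_integral_besselK_sq (r : ℝ) {x : ℝ} (hx : 0 < x) :
    Integrable (fun v : ℝ => besselK (r * Complex.I) (x * √(1 + v ^ 2)) ^ 2) ∧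
      ∫ v : ℝ, besselK (r * Complex.I) (x * √(1 + v ^ 2)) ^ 2 =
        (Real.pi / (2 * x) : ℝ) * ∫ p : ℝ,
          Complex.exp (-2 * x * Complex.cosh p + 2 * r * Complex.I * p) / Complex.cosh p := by
  have hint := integrable_cexp_mul_exp_neg_mul_sqrt_mul_cosh_mul_cosh r hx
  have hint2 := hint.integral_prod_left
  have hsq (v : ℝ) := besselK_mul_I_sq r (z := x * √(1 + v ^ 2)) (by positivity)
  simp only [hsq]
  refine ⟨hint2.integral_prod_left.const_mul _, ?_⟩
  rw [integral_const_mul, integral_integral_swap hint2, ← integral_const_mul,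
    ← integral_const_mul]
  refine integral_congr_ae (ae_of_all _ fun p => ?_)
  have hc : 0 < 2 * x * Real.cosh p := mul_pos (by positivity) (Real.cosh_pos p)
  -- For fixed `p` the `v, q` integral is the planar one with `c = 2x cosh p`; its `1/c` creates the
  -- denominator `cosh p`.
  have h := integral_integral_exp_neg_mul_sqrt_mul_cosh hc
  have h2 : ∫ v : ℝ, ∫ q : ℝ, Complex.exp (2 * r * Complex.I * p) *
      (Real.exp (-2 * (x * √(1 + v ^ 2)) * (Real.cosh p * Real.cosh q)) : ℝ) =
      Complex.exp (2 * r * Complex.I * p) *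
        ((2 * Real.pi * (Real.exp (-(2 * x * Real.cosh p)) / (2 * x * Real.cosh p)) : ℝ) : ℂ) := by
    rw [← h, ← integral_complex_ofReal, ← integral_const_mul]
    refine integral_congr_ae (ae_of_all _ fun v => ?_)
    simp only
    rw [← integral_complex_ofReal, ← integral_const_mul]
    refine integral_congr_ae (ae_of_all _ fun q => ?_)
    simp only
    congr 3
    ring
  simp only [h2, Complex.exp_add]
  push_cast
  have hcosh : Complex.cosh p ≠ 0 := by
    rw [← Complex.ofReal_cosh]
    exact_mod_cast (Real.cosh_pos p).ne'
  have hx0 : (x : ℂ) ≠ 0 := by exact_mod_cast hx.ne'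
  field_simp

theorem integrable_norm_besselK_sq (r : ℝ) {x : ℝ} (hx : 0 < x) :
    Integrable fun v : ℝ => ‖besselK (r * Complex.I) (x * √(1 + v ^ 2))‖ ^ 2 := by
  simpa only [norm_pow] using (integrable_and_integral_besselK_sq r hx).1.norm

theorem integral_norm_besselK_sq_le {r x T : ℝ} (hr : 0 ≤ r) (hrT : r ≤ 3 / 2 * T) (hT : 2 ≤ T)
    (hx : 0 < x) :
    ∫ v : ℝ, ‖besselK (r * Complex.I) (x * √(1 + v ^ 2))‖ ^ 2 ≤
      8 * Real.pi * Real.exp (3 / 2 * Real.pi) * Real.exp (-(Real.pi * r)) * Real.log T / x *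
        Real.exp (-2 * x / T) := by
  have h1 : ((∫ v : ℝ, ‖besselK (r * Complex.I) (x * √(1 + v ^ 2))‖ ^ 2 : ℝ) : ℂ) =
      ∫ v : ℝ, besselK (r * Complex.I) (x * √(1 + v ^ 2)) ^ 2 := by
    rw [← integral_complex_ofReal]
    simp only [ofReal_norm_besselK_mul_I_sq]
  have h2 : ∫ v : ℝ, ‖besselK (r * Complex.I) (x * √(1 + v ^ 2))‖ ^ 2 =
      ‖∫ v : ℝ, besselK (r * Complex.I) (x * √(1 + v ^ 2)) ^ 2‖ := by
    rw [← h1, Complex.norm_real, Real.norm_of_nonneg (integral_nonneg fun v => by positivity)]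
  have hlog : 0 ≤ Real.log T := Real.log_nonneg (by linarith)
  rw [h2, (integrable_and_integral_besselK_sq r hx).2, norm_mul, Complex.norm_real,
    Real.norm_of_nonneg (by positivity)]
  calc _ ≤ Real.pi / (2 * x) * (Real.exp (-2 * r * Real.arccos T⁻¹) * Real.exp (-2 * x / T) *
        (16 * Real.log T)) := by
        gcongr
        exact norm_integral_exp_div_cosh_le hr hx hT
    _ ≤ Real.pi / (2 * x) * (Real.exp (3 / 2 * Real.pi) * Real.exp (-(Real.pi * r)) *
        Real.exp (-2 * x / T) * (16 * Real.log T)) := by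
        gcongr
        exact exp_neg_two_mul_arccos_inv_le hrT hT
    _ = _ := by ring

/-! ### Cauchy–Schwarz for the product of Bessel functions -/

theorem stronglyMeasurable_besselK (ν : ℂ) : StronglyMeasurable (besselK ν) := by
  have h : Continuous (Function.uncurry fun x t : ℝ => besselKIntegrand ν x t) := by
    unfold besselKIntegrand Function.uncurry
    fun_prop
  exact h.stronglyMeasurable.integral_prod_right

theorem integral_Ioi_eq_half_integral_of_even {f : ℝ → ℝ} (hf : ∀ v, f |v| = f v) :
    ∫ v in Set.Ioi (0 : ℝ), f v = 1 / 2 * ∫ v, f v := by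
  have h := integral_comp_abs (f := f)
  simp only [hf] at h
  linarith

/-- Substitution `v = u ^ p`: the factor `|p| = 1/2` of the Jacobian matches the passage from the
half-line to the whole line. -/
theorem integrableOn_and_integral_rpow_mul_norm_besselK_sq (r : ℝ) {x p : ℝ} (hx : 0 < x)
    (hp : |p| = 1 / 2) :
    IntegrableOn (fun u : ℝ => u ^ (p - 1) *
        ‖besselK (r * Complex.I) (x * √(1 + (u ^ p) ^ 2))‖ ^ 2) (Set.Ioi 0) ∧
      ∫ u in Set.Ioi (0 : ℝ), u ^ (p - 1) *
        ‖besselK (r * Complex.I) (x * √(1 + (u ^ p) ^ 2))‖ ^ 2 =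
      ∫ v : ℝ, ‖besselK (r * Complex.I) (x * √(1 + v ^ 2))‖ ^ 2 := by
  have hp0 : p ≠ 0 := by
    rintro rfl
    norm_num at hp
  set g : ℝ → ℝ := fun v => ‖besselK (r * Complex.I) (x * √(1 + v ^ 2))‖ ^ 2 with hg
  have h1 := (integrableOn_Ioi_comp_rpow_iff g hp0).2 (integrable_norm_besselK_sq r hx).integrableOn
  have h2 := integral_comp_rpow_Ioi g hp0
  rw [integral_Ioi_eq_half_integral_of_even (f := g) (fun v => by simp [hg])] at h2
  simp only [hp, smul_eq_mul, mul_assoc] at h1 h2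
  constructor
  · refine (h1.const_mul 2).congr (ae_of_all _ fun u => ?_)
    simp only
    ring
  · rw [integral_const_mul] at h2
    linarith

/-- The Cauchy--Schwarz inequality for a product of two `K`-Bessel functions, with
`u ↦ u⁻¹` exchanging the two factors. -/
theorem integrableOn_and_integral_norm_besselK_mul_le (r : ℝ) {x₁ x₂ : ℝ} (h₁ : 0 < x₁)
    (h₂ : 0 < x₂) :
    IntegrableOn (fun u : ℝ => ‖besselK (r * Complex.I) (x₁ * √(1 + u))‖ *
        ‖besselK (r * Complex.I) (x₂ * √(1 + u⁻¹))‖ / u) (Set.Ioi 0) ∧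
      ∫ u in Set.Ioi (0 : ℝ), ‖besselK (r * Complex.I) (x₁ * √(1 + u))‖ *
        ‖besselK (r * Complex.I) (x₂ * √(1 + u⁻¹))‖ / u ≤
      √(∫ v : ℝ, ‖besselK (r * Complex.I) (x₁ * √(1 + v ^ 2))‖ ^ 2) *
        √(∫ v : ℝ, ‖besselK (r * Complex.I) (x₂ * √(1 + v ^ 2))‖ ^ 2) := by
  obtain ⟨hi1, hv1⟩ := integrableOn_and_integral_rpow_mul_norm_besselK_sq r (p := 1 / 2) h₁
    (by norm_num)
  obtain ⟨hi2, hv2⟩ := integrableOn_and_integral_rpow_mul_norm_besselK_sq r (p := -(1 / 2)) h₂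
    (by rw [abs_neg]; norm_num)
  set μ := volume.restrict (Set.Ioi (0 : ℝ)) with hμ
  -- The weight `u⁻¹` is split unevenly so that the squared weights `u ^ (-1/2)` and `u ^ (-3/2)`
  -- are, up to the constant `1/2`, the Jacobians of `u ^ (1/2)` and `u ^ (-1/2)`.
  set F : ℝ → ℝ := fun u => u ^ (-(1 / 4) : ℝ) * ‖besselK (r * Complex.I) (x₁ * √(1 + u))‖ with hF
  set G : ℝ → ℝ := fun u => u ^ (-(3 / 4) : ℝ) * ‖besselK (r * Complex.I) (x₂ * √(1 + u⁻¹))‖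
    with hG
  have hFsq : (fun u : ℝ => u ^ ((1 / 2 : ℝ) - 1) *
      ‖besselK (r * Complex.I) (x₁ * √(1 + (u ^ (1 / 2 : ℝ)) ^ 2))‖ ^ 2) =ᵐ[μ]
      fun u => F u ^ 2 := by
    filter_upwards [ae_restrict_mem measurableSet_Ioi] with u hu
    have hu' : 0 < u := hu
    simp only [hF, mul_pow, ← Real.rpow_mul_natCast hu'.le]
    norm_num
  have hGsq : (fun u : ℝ => u ^ (-(1 / 2 : ℝ) - 1) *
      ‖besselK (r * Complex.I) (x₂ * √(1 + (u ^ (-(1 / 2) : ℝ)) ^ 2))‖ ^ 2) =ᵐ[μ]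
      fun u => G u ^ 2 := by
    filter_upwards [ae_restrict_mem measurableSet_Ioi] with u hu
    have hu' : 0 < u := hu
    simp only [hG, mul_pow, ← Real.rpow_mul_natCast hu'.le]
    norm_num [Real.rpow_neg_one]
  have hFG : (fun u : ℝ => F u * G u) =ᵐ[μ] fun u =>
      ‖besselK (r * Complex.I) (x₁ * √(1 + u))‖ *
        ‖besselK (r * Complex.I) (x₂ * √(1 + u⁻¹))‖ / u := by
    filter_upwards [ae_restrict_mem measurableSet_Ioi] with u hu
    have hu' : 0 < u := hu
    have h3 : u ^ (-(1 / 4) : ℝ) * u ^ (-(3 / 4) : ℝ) = u⁻¹ := by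
      rw [← Real.rpow_add hu', ← Real.rpow_neg_one]
      norm_num
    simp only [hF, hG]
    rw [mul_mul_mul_comm, h3]
    ring
  have hmF : AEStronglyMeasurable F μ := by
    refine Measurable.aestronglyMeasurable (Measurable.mul (by fun_prop) (Measurable.norm ?_))
    exact (stronglyMeasurable_besselK _).measurable.comp (by fun_prop)
  have hmG : AEStronglyMeasurable G μ := by
    refine Measurable.aestronglyMeasurable (Measurable.mul (by fun_prop) (Measurable.norm ?_))
    exact (stronglyMeasurable_besselK _).measurable.comp (by fun_prop)
  have hF2 : MemLp F 2 μ := (memLp_two_iff_integrable_sq hmF).2 (Integrable.congr hi1 hFsq)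
  have hG2 : MemLp G 2 μ := (memLp_two_iff_integrable_sq hmG).2 (Integrable.congr hi2 hGsq)
  refine ⟨(hF2.integrable_mul hG2).congr hFG, ?_⟩
  have hnF : 0 ≤ᵐ[μ] F := by
    filter_upwards [ae_restrict_mem measurableSet_Ioi] with u hu
    have hu' : 0 < u := hu
    simp only [hF, Pi.zero_apply]
    positivity
  have hnG : 0 ≤ᵐ[μ] G := by
    filter_upwards [ae_restrict_mem measurableSet_Ioi] with u hu
    have hu' : 0 < u := hu
    simp only [hG, Pi.zero_apply]
    positivity
  have hCS := integral_mul_le_Lp_mul_Lq_of_nonneg (μ := μ) (p := 2) (q := 2)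
    Real.HolderConjugate.two_two hnF hnG (by simpa using hF2) (by simpa using hG2)
  rw [integral_congr_ae hFG] at hCS
  refine hCS.trans_eq ?_
  simp only [Real.rpow_two, ← Real.sqrt_eq_rpow]
  rw [← hv1, ← hv2, integral_congr_ae hFsq, integral_congr_ae hGsq]

/-! ### Gamma factors and rapid decay -/

/-- Euler's reflection formula, since `1 - s` is the conjugate of `s` on the line `Re s = 1/2`. -/
theorem norm_Gamma_half_add_mul_I_sq (x : ℝ) :
    ‖Complex.Gamma (1 / 2 + x * Complex.I)‖ ^ 2 = Real.pi / Real.cosh (Real.pi * x) := by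
  have h := Complex.Gamma_mul_Gamma_one_sub (1 / 2 + x * Complex.I)
  have h1 : 1 - (1 / 2 + x * Complex.I) = (starRingEnd ℂ) (1 / 2 + x * Complex.I) := by
    simp only [map_add, map_mul, map_div₀, map_one, map_ofNat, Complex.conj_ofReal, Complex.conj_I]
    ring
  have h2 : Complex.sin (Real.pi * (1 / 2 + x * Complex.I)) = Real.cosh (Real.pi * x) := by
    rw [show (Real.pi : ℂ) * (1 / 2 + x * Complex.I) =
      ((Real.pi * x : ℝ) : ℂ) * Complex.I + Real.pi / 2 by push_cast; ring,
      Complex.sin_add_pi_div_two, Complex.cos_mul_I, Complex.ofReal_cosh]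
  rw [h1, Complex.Gamma_conj, Complex.mul_conj, h2, Complex.normSq_eq_norm_sq] at h
  exact_mod_cast h

theorem inv_norm_Gamma_half_add_mul_I_le {x : ℝ} (hx : 0 ≤ x) :
    ‖Complex.Gamma (1 / 2 + x * Complex.I)‖⁻¹ ≤
      (√Real.pi)⁻¹ * Real.exp (Real.pi * x / 2) := by
  refine le_of_sq_le_sq ?_ (by positivity)
  have h1 : Real.cosh (Real.pi * x) ≤ Real.exp (Real.pi * x) := by
    rw [Real.cosh_eq]
    have : Real.exp (-(Real.pi * x)) ≤ Real.exp (Real.pi * x) := by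
      rw [Real.exp_le_exp]
      have := mul_nonneg Real.pi_pos.le hx
      linarith
    linarith
  rw [inv_pow, norm_Gamma_half_add_mul_I_sq, inv_div, mul_pow, inv_pow,
    Real.sq_sqrt Real.pi_pos.le, ← Real.exp_nat_mul, div_eq_inv_mul]
  gcongr
  calc _ ≤ _ := h1
    _ = _ := by
      congr 1
      push_cast
      ring

theorem exp_neg_two_pi_mul_le {A s : ℝ} (hA : 0 < A) (hs : 0 ≤ s) :
    Real.exp (-2 * Real.pi * s) ≤
      Real.exp (A * Real.log (A + 1) + 1) * (1 + s) ^ (-A) := by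
  have h1 : Real.log (1 + s) ≤ Real.log (A + 1) + (1 + s) / (A + 1) - 1 := by
    -- Tangent line of the logarithm at `A + 1`: its slope `1/(A + 1)`, times `A`, stays below `1`.
    have := Real.log_le_sub_one_of_pos (show 0 < (1 + s) / (A + 1) by positivity)
    rw [Real.log_div (by positivity) (by positivity)] at this
    linarith
  have h2 : A * ((1 + s) / (A + 1)) ≤ 1 + s := by
    rw [← mul_div_assoc, div_le_iff₀ (by positivity)]
    nlinarith
  rw [Real.rpow_def_of_pos (by positivity), ← Real.exp_add, Real.exp_le_exp]
  nlinarith [Real.pi_gt_three]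

/-! ### Assembling the bound for the Whittaker function -/

theorem norm_whittakerIntegrand {ν₁ ν₂ : ℂ} {r : ℝ} (h₁ : ν₁.re = 0) (h₂ : ν₂.re = 0)
    (hr : 3 / 2 * (ν₁ + ν₂) = r * Complex.I) (y₁ y₂ : ℝ) {u : ℝ} (hu : 0 < u) :
    ‖whittakerIntegrand ν₁ ν₂ y₁ y₂ u‖ =
      ‖besselK (r * Complex.I) (2 * Real.pi * y₁ * √(1 + u))‖ *
        ‖besselK (r * Complex.I) (2 * Real.pi * y₂ * √(1 + u⁻¹))‖ / u := by
  have h3 : ((3 / 4 : ℂ) * (ν₁ - ν₂)).re = 0 := by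
    rw [show (3 / 4 : ℂ) = ((3 / 4 : ℝ) : ℂ) by norm_num, Complex.re_ofReal_mul]
    simp [h₁, h₂]
  rw [whittakerIntegrand, hr, norm_div, norm_mul, norm_mul,
    Complex.norm_cpow_eq_rpow_re_of_pos hu, h3, Real.rpow_zero, mul_one, Complex.norm_real,
    Real.norm_of_nonneg hu.le]

theorem aestronglyMeasurable_whittakerIntegrand (ν₁ ν₂ : ℂ) (y₁ y₂ : ℝ) :
    AEStronglyMeasurable (whittakerIntegrand ν₁ ν₂ y₁ y₂) (volume.restrict (Set.Ioi 0)) := by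
  have h1 : Measurable fun u : ℝ => besselK (3 / 2 * (ν₁ + ν₂)) (2 * Real.pi * y₁ * √(1 + u)) :=
    (stronglyMeasurable_besselK _).measurable.comp (by fun_prop)
  have h2 : Measurable fun u : ℝ => besselK (3 / 2 * (ν₁ + ν₂)) (2 * Real.pi * y₂ * √(1 + u⁻¹)) :=
    (stronglyMeasurable_besselK _).measurable.comp (by fun_prop)
  have h3 : Measurable fun u : ℝ => (u : ℂ) ^ (3 / 4 * (ν₁ - ν₂)) := by fun_prop
  exact (((h1.mul h2).mul h3).div Complex.measurable_ofReal).aestronglyMeasurable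

/-- The third parameter is the sum of the other two, so the half-exponents add up to `π(a + b)`,
exactly the decay rate of the Bessel integral with `r = a + b`. -/
theorem prod_inv_norm_Gamma_le {a b : ℝ} (ha : 0 ≤ a) (hb : 0 ≤ b) :
    ‖Complex.Gamma (1 / 2 + (a + b : ℝ) * Complex.I)‖⁻¹ *
        ‖Complex.Gamma (1 / 2 + a * Complex.I)‖⁻¹ * ‖Complex.Gamma (1 / 2 + b * Complex.I)‖⁻¹ ≤
      (Real.pi ^ (3 / 2 : ℝ))⁻¹ * Real.exp (Real.pi * (a + b)) := by
  have hpi : Real.pi ^ (3 / 2 : ℝ) = √Real.pi * √Real.pi * √Real.pi := by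
    rw [show (3 / 2 : ℝ) = 1 + 1 / 2 by norm_num, Real.rpow_add Real.pi_pos, Real.rpow_one,
      ← Real.sqrt_eq_rpow, Real.mul_self_sqrt Real.pi_pos.le]
  calc _ ≤ ((√Real.pi)⁻¹ * Real.exp (Real.pi * (a + b) / 2)) *
        ((√Real.pi)⁻¹ * Real.exp (Real.pi * a / 2)) *
        ((√Real.pi)⁻¹ * Real.exp (Real.pi * b / 2)) := by
        gcongr
        · exact inv_norm_Gamma_half_add_mul_I_le (add_nonneg ha hb)
        · exact inv_norm_Gamma_half_add_mul_I_le ha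
        · exact inv_norm_Gamma_half_add_mul_I_le hb
    _ = (Real.pi ^ (3 / 2 : ℝ))⁻¹ * (Real.exp (Real.pi * (a + b) / 2) *
        Real.exp (Real.pi * a / 2) * Real.exp (Real.pi * b / 2)) := by
        rw [hpi, mul_inv, mul_inv]
        ring
    _ = _ := by
        rw [← Real.exp_add, ← Real.exp_add]
        congr 2
        ring

theorem integral_norm_besselK_mul_le {r y₁ y₂ T : ℝ} (hr : 0 ≤ r) (hrT : r ≤ 3 / 2 * T)
    (hT : 2 ≤ T) (h₁ : 0 < y₁) (h₂ : 0 < y₂) :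
    ∫ u in Set.Ioi (0 : ℝ), ‖besselK (r * Complex.I) (2 * Real.pi * y₁ * √(1 + u))‖ *
        ‖besselK (r * Complex.I) (2 * Real.pi * y₂ * √(1 + u⁻¹))‖ / u ≤
      4 * Real.exp (3 / 2 * Real.pi) * Real.exp (-(Real.pi * r)) * Real.log T / √(y₁ * y₂) *
        (Real.exp (-2 * Real.pi * (y₁ / T)) * Real.exp (-2 * Real.pi * (y₂ / T))) := by
  have hpi := Real.pi_pos
  have hlog : 0 ≤ Real.log T := Real.log_nonneg (by linarith)
  have hL {y : ℝ} (hy : 0 < y) := integral_norm_besselK_sq_le hr hrT hT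
    (show 0 < 2 * Real.pi * y by positivity)
  have hsqrt {y : ℝ} (hy : 0 < y) :
      √(∫ v : ℝ, ‖besselK (r * Complex.I) (2 * Real.pi * y * √(1 + v ^ 2))‖ ^ 2) ≤
        √(4 * Real.exp (3 / 2 * Real.pi) * Real.exp (-(Real.pi * r)) * Real.log T) / √y *
          Real.exp (-2 * Real.pi * (y / T)) := by
    refine Real.sqrt_le_iff.2 ⟨by positivity, (hL hy).trans_eq ?_⟩
    rw [mul_pow, div_pow, Real.sq_sqrt (by positivity), Real.sq_sqrt hy.le, ← Real.exp_nat_mul,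
      show -2 * (2 * Real.pi * y) / T = ((2 : ℕ) : ℝ) * (-2 * Real.pi * (y / T)) by
        push_cast; ring]
    field_simp
    ring
  refine (integrableOn_and_integral_norm_besselK_mul_le r (by positivity) (by positivity)).2.trans
    ((mul_le_mul (hsqrt h₁) (hsqrt h₂) (by positivity) (by positivity)).trans_eq ?_)
  set D := 4 * Real.exp (3 / 2 * Real.pi) * Real.exp (-(Real.pi * r)) * Real.log T with hD
  have hD0 : 0 ≤ D := by positivity
  rw [Real.sqrt_mul h₁.le, mul_mul_mul_comm, div_mul_div_comm, Real.mul_self_sqrt hD0]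

theorem norm_normalizedWhittaker_le {ν₁ ν₂ : ℂ} {a b T y₁ y₂ : ℝ} (ha : 0 ≤ a) (hb : 0 ≤ b)
    (h₁ : 3 / 2 * ν₁ = a * Complex.I) (h₂ : 3 / 2 * ν₂ = b * Complex.I)
    (hT : 2 ≤ T) (habT : a + b ≤ 3 / 2 * T) (hy₁ : 0 < y₁) (hy₂ : 0 < y₂) :
    IntegrableOn (whittakerIntegrand ν₁ ν₂ y₁ y₂) (Set.Ioi 0) ∧
      ‖normalizedWhittaker ν₁ ν₂ y₁ y₂‖ ≤ 16 * Real.exp (3 / 2 * Real.pi) * Real.log T *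
        √(y₁ * y₂) *
        (Real.exp (-2 * Real.pi * (y₁ / T)) * Real.exp (-2 * Real.pi * (y₂ / T))) := by
  have hpi := Real.pi_pos
  have hre₁ : ν₁.re = 0 := by
    rw [show ν₁ = ((2 / 3 * a : ℝ) : ℂ) * Complex.I by push_cast; linear_combination 2 / 3 * h₁]
    simp
  have hre₂ : ν₂.re = 0 := by
    rw [show ν₂ = ((2 / 3 * b : ℝ) : ℂ) * Complex.I by push_cast; linear_combination 2 / 3 * h₂]
    simp
  have hr : 3 / 2 * (ν₁ + ν₂) = ((a + b : ℝ) : ℂ) * Complex.I := by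
    push_cast
    linear_combination h₁ + h₂
  have hnorm : (fun u => ‖besselK ((a + b : ℝ) * Complex.I) (2 * Real.pi * y₁ * √(1 + u))‖ *
        ‖besselK ((a + b : ℝ) * Complex.I) (2 * Real.pi * y₂ * √(1 + u⁻¹))‖ / u)
      =ᵐ[volume.restrict (Set.Ioi (0 : ℝ))] fun u => ‖whittakerIntegrand ν₁ ν₂ y₁ y₂ u‖ := by
    filter_upwards [ae_restrict_mem measurableSet_Ioi] with u hu
    exact (norm_whittakerIntegrand hre₁ hre₂ hr y₁ y₂ hu).symm
  have hint := (integrableOn_and_integral_norm_besselK_mul_le (a + b)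
    (show 0 < 2 * Real.pi * y₁ by positivity) (show 0 < 2 * Real.pi * y₂ by positivity)).1
  refine ⟨(integrable_norm_iff (aestronglyMeasurable_whittakerIntegrand ν₁ ν₂ y₁ y₂)).1
    (Integrable.congr hint hnorm), ?_⟩
  have hI := integral_norm_besselK_mul_le (add_nonneg ha hb) habT hT hy₁ hy₂
  rw [integral_congr_ae hnorm] at hI
  have hG := prod_inv_norm_Gamma_le ha hb
  have hlog : 0 ≤ Real.log T := Real.log_nonneg (by linarith)
  have hre : ((ν₁ - ν₂) / 2).re = 0 := by simp [hre₁, hre₂]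
  rw [normalizedWhittaker, hr, h₁, h₂, norm_mul, norm_mul,
    Complex.norm_cpow_eq_rpow_re_of_pos (div_pos hy₁ hy₂), hre, Real.rpow_zero, mul_one,
    Complex.norm_real, Real.norm_of_nonneg (by positivity)]
  set E := Real.exp (-2 * Real.pi * (y₁ / T)) * Real.exp (-2 * Real.pi * (y₂ / T)) with hE
  have hE0 : 0 ≤ E := by positivity
  have hs : y₁ * y₂ / √(y₁ * y₂) = √(y₁ * y₂) := Real.div_sqrt
  calc _ ≤ 4 * Real.pi ^ (3 / 2 : ℝ) *
          ((Real.pi ^ (3 / 2 : ℝ))⁻¹ * Real.exp (Real.pi * (a + b))) * (y₁ * y₂) *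
        (4 * Real.exp (3 / 2 * Real.pi) * Real.exp (-(Real.pi * (a + b))) * Real.log T /
          √(y₁ * y₂) * E) := by
        gcongr
        exact (norm_integral_le_integral_norm _).trans hI
    _ = 16 * Real.exp (3 / 2 * Real.pi) * Real.log T * (y₁ * y₂ / √(y₁ * y₂)) * E *
        (Real.pi ^ (3 / 2 : ℝ) * (Real.pi ^ (3 / 2 : ℝ))⁻¹) *
        (Real.exp (Real.pi * (a + b)) * Real.exp (-(Real.pi * (a + b)))) := by ring
    _ = _ := by
        rw [hs, ← Real.exp_add, add_neg_cancel, Real.exp_zero, mul_one,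
          mul_inv_cancel₀ (by positivity), mul_one]

/-! ### Spectral parameters and the theorem -/

theorem IsTemperedSpectralParameter.eq_mul_I {ν₀ ν₁ ν₂ : ℂ}
    (h : IsTemperedSpectralParameter ν₀ ν₁ ν₂) :
    ∃ a b : ℝ, 0 ≤ a ∧ 0 ≤ b ∧ ν₁ = a * Complex.I ∧ ν₂ = b * Complex.I ∧
      spectralSize ν₀ ν₁ ν₂ = max 2 (a + b) := by
  have h1 : ν₁ = ν₁.im * Complex.I := by
    apply Complex.ext <;> simp [h.re_one]
  have h2 : ν₂ = ν₂.im * Complex.I := by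
    apply Complex.ext <;> simp [h.re_two]
  refine ⟨ν₁.im, ν₂.im, h.im_one_nonneg, h.im_two_nonneg, h1, h2, ?_⟩
  have ha := h.im_one_nonneg
  have hb := h.im_two_nonneg
  have hnorm {t : ℝ} (ht : 0 ≤ t) : ‖(t : ℂ) * Complex.I‖ = t := by
    rw [norm_mul, Complex.norm_I, mul_one, Complex.norm_real, Real.norm_of_nonneg ht]
  have h0 : ν₀ = ((ν₁.im + ν₂.im : ℝ) : ℂ) * Complex.I := by
    rw [h.sum_eq]
    push_cast
    rw [add_mul, ← h1, ← h2]
  have n1 : ‖ν₁‖ = ν₁.im := by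
    conv_lhs => rw [h1]
    exact hnorm ha
  have n2 : ‖ν₂‖ = ν₂.im := by
    conv_lhs => rw [h2]
    exact hnorm hb
  rw [spectralSize, n1, n2, h0, hnorm (add_nonneg ha hb),
    max_eq_left (max_le (show ν₁.im ≤ ν₁.im + ν₂.im by linarith) (by linarith))]

theorem mainTheorem4 :
    (∃ c C : ℝ, 0 < c ∧ 0 < C ∧ ∀ ν₀ ν₁ ν₂ : ℂ, IsTemperedSpectralParameter ν₀ ν₁ ν₂ →
      ∃ lam : ℝ, 0 < lam ∧ (lam : ℂ) = laplaceEigenvalue ν₁ ν₂ ∧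
        c * √lam ≤ spectralSize ν₀ ν₁ ν₂ ∧ spectralSize ν₀ ν₁ ν₂ ≤ C * √lam) ∧
    (∀ A : ℝ, 0 < A → ∃ C : ℝ, 0 < C ∧
      ∀ ν₀ ν₁ ν₂ : ℂ, IsTemperedSpectralParameter ν₀ ν₁ ν₂ →
      ∀ y₁ y₂ : ℝ, 0 < y₁ → 0 < y₂ →
        IntegrableOn (whittakerIntegrand ν₁ ν₂ y₁ y₂) (Set.Ioi 0) ∧
        ‖normalizedWhittaker ν₁ ν₂ y₁ y₂‖ ≤
          C * Real.log (spectralSize ν₀ ν₁ ν₂) * √(y₁ * y₂) *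
            (1 + y₁ / spectralSize ν₀ ν₁ ν₂) ^ (-A) *
            (1 + y₂ / spectralSize ν₀ ν₁ ν₂) ^ (-A)) := by
  constructor
  · refine ⟨1 / 2, 2, by norm_num, by norm_num, fun ν₀ ν₁ ν₂ hν => ?_⟩
    obtain ⟨a, b, ha, hb, rfl, rfl, hT⟩ := hν.eq_mul_I
    have hab := mul_nonneg ha hb
    refine ⟨1 + 3 * (a ^ 2 + a * b + b ^ 2), by positivity, ?_, ?_, ?_⟩
    · rw [laplaceEigenvalue]
      push_cast
      linear_combination (3 * (a : ℂ) ^ 2 + 3 * a * b + 3 * b ^ 2) * Complex.I_sq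
    · rw [hT]
      -- The radicand is at most `1 + 3(a + b)²`, and `1 ≤ max 2 (a + b) ^ 2` absorbs the `1`.
      have h2 : √(1 + 3 * (a ^ 2 + a * b + b ^ 2)) ≤ 2 * max 2 (a + b) := by
        refine Real.sqrt_le_iff.2 ⟨by positivity, ?_⟩
        have h3 : (a + b) ^ 2 ≤ max 2 (a + b) ^ 2 :=
          pow_le_pow_left₀ (by positivity) (le_max_right _ _) 2
        have h4 : (2 : ℝ) ^ 2 ≤ max 2 (a + b) ^ 2 :=
          pow_le_pow_left₀ (by positivity) (le_max_left _ _) 2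
        nlinarith
      linarith
    · rw [hT]
      have h2 : 1 ≤ √(1 + 3 * (a ^ 2 + a * b + b ^ 2)) := by
        rw [Real.one_le_sqrt]
        nlinarith [sq_nonneg a, sq_nonneg b]
      have h3 : (a + b) / 2 ≤ √(1 + 3 * (a ^ 2 + a * b + b ^ 2)) :=
        Real.le_sqrt_of_sq_le (by nlinarith [sq_nonneg a, sq_nonneg b])
      exact max_le (by linarith) (by linarith)
  · intro A hA
    -- The last factor is squared because the exponential is traded for a power once for each of
    -- `y₁`, `y₂`.
    refine ⟨16 * Real.exp (3 / 2 * Real.pi) * Real.exp (A * Real.log (A + 1) + 1) ^ 2,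
      by positivity, fun ν₀ ν₁ ν₂ hν y₁ y₂ hy₁ hy₂ => ?_⟩
    obtain ⟨a, b, ha, hb, h₁, h₂, hT⟩ := hν.eq_mul_I
    rw [hT]
    set T := max 2 (a + b) with hTdef
    have hT2 : 2 ≤ T := le_max_left _ _
    have habT : a + b ≤ T := le_max_right _ _
    have hlog : 0 ≤ Real.log T := Real.log_nonneg (by linarith)
    have hT0 : 0 < T := by linarith
    obtain ⟨hint, hle⟩ := norm_normalizedWhittaker_le (ν₁ := ν₁) (ν₂ := ν₂) (T := T)
      (a := 3 / 2 * a) (b := 3 / 2 * b)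
      (by positivity) (by positivity) (by rw [h₁]; push_cast; ring) (by rw [h₂]; push_cast; ring)
      hT2 (by linarith) hy₁ hy₂
    refine ⟨hint, hle.trans ?_⟩
    have e₁ := exp_neg_two_pi_mul_le hA (div_pos hy₁ hT0).le
    have e₂ := exp_neg_two_pi_mul_le hA (div_pos hy₂ hT0).le
    calc _ ≤ 16 * Real.exp (3 / 2 * Real.pi) * Real.log T * √(y₁ * y₂) *
          ((Real.exp (A * Real.log (A + 1) + 1) * (1 + y₁ / T) ^ (-A)) *
            (Real.exp (A * Real.log (A + 1) + 1) * (1 + y₂ / T) ^ (-A))) := by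
          gcongr
      _ = _ := by ring
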